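/- For an integer $k\ge 2$ let $\Sigma_k=\{0,1,\dots,k-1\}$. A word $w=[a_1,b_1]\cdots[a_t,b_t]$ over $\Sigma_k\times\Sigma_k$ represents, with most significant digit first, the numerator $\sum_{i=1}^t a_ik^{t-i}$ and the denominator $\sum_{i=1}^t b_ik^{t-i}$; if the denominator is nonzero, $\mathrm{quo}_k(w)$ denotes their quotient. A deterministic finite automaton $M$ over $\Sigma_k\times\Sigma_k$ accepts the set of rationals $S\subseteq\mathbb{Q}_{\ge 0}$ if every word in its language $L(M)$ has a nonzero denominator and $S=\{\mathrm{quo}_k(w): w\in L(M)\}$. **Theorem.** It is decidable, given an integer $k\ge 2$, a rational number $p/q\ge 0$ (as a pair of natural numbers $p,q$ with $q\ne 0$) and a deterministic finite automaton $M$ accepting a set of rationals $S$, whether $p/q$ is an accumulation point of $S$ in $\mathbb{R}$. That is, there is a single algorithm (a total computable function) that, on every such input, with $M$ given by its number of states, its start state, its accepting states and its transition table, answers whether every neighbourhood of $p/q$ in $\mathbb{R}$ contains an element of $S$ different from $p/q$. -/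

import Mathlib

namespace AutomaticRationals

/-- The alphabet `Σ_k × Σ_k`, where `Σ_k = {0, …, k-1}`. -/
abbrev PairLetter (k : ℕ) : Type := Fin k × Fin k

/-- `[w]_k`: the integer represented in base `k` by `w`, most significant digit first.
(`Nat.ofDigits` expects the least significant digit first, hence the reversal.) -/
def value (k : ℕ) (w : List (Fin k)) : ℕ :=
  Nat.ofDigits k (w.map fun a => (a : ℕ)).reverse

/-- `[π₁(w)]_k`. -/
def numerator (k : ℕ) (w : List (PairLetter k)) : ℕ := value k (w.map Prod.fst)

/-- `[π₂(w)]_k`. -/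
def denominator (k : ℕ) (w : List (PairLetter k)) : ℕ := value k (w.map Prod.snd)

/-- `quo_k(w) = [π₁(w)]_k / [π₂(w)]_k`, meaningful when the denominator is nonzero. -/
def quo (k : ℕ) (w : List (PairLetter k)) : ℚ :=
  (numerator k w : ℚ) / (denominator k w : ℚ)

/-- The automaton `M` accepts the set of rationals `S`: no accepted word has denominator `0`,
so that `quo_k(L(M))` is defined, and `S = quo_k(L(M))`. -/
def AcceptsRationals {k : ℕ} {σ : Type*} (M : DFA (PairLetter k) σ) (S : Set ℚ) : Prop :=
  (∀ w ∈ M.accepts, denominator k w ≠ 0) ∧ S = quo k '' {w | w ∈ M.accepts}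

/-- A finite description of an automaton: base, number of states, start state, the list telling
which states are accepting, and the transition table. -/
abbrev DFACode : Type := ℕ × ℕ × ℕ × List Bool × List (List (List ℕ))

open Classical in
/-- The description of the automaton `M` with states `0, …, n-1`: entry `s` of the fourth component
tells whether the state `s` is accepting, and entry `s`, `a`, `b` of the table is the state
reached from the state `s` on reading the letter `[a, b]`. -/
noncomputable def dfaCode {k n : ℕ} (M : DFA (PairLetter k) (Fin n)) : DFACode :=
  (k, n, (M.start : ℕ),
    List.ofFn (fun s : Fin n => decide (s ∈ M.accept)),
    List.ofFn (fun s : Fin n => List.ofFn (fun a : Fin k => List.ofFn (fun b : Fin k =>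
      (M.step s (a, b) : ℕ)))))

end AutomaticRationals

namespace AutomaticRationals

variable {k n : ℕ}

/-! Write d(w) for `deviation`, so that quo(w) - p/q = d(w) / (q · denominator). Appending a letter
multiplies d by k and adds a term of size at most (p + q)(k - 1). Hence once |d| exceeds p + q it
grows geometrically and never returns (`lt_abs_deviation_append`). A quotient very close to p/q, but
different from it, therefore needs a long stretch after the first nonzero denominator digit on which
|d| ≤ p + q; conversely such a stretch forces closeness (`accPt_iff_forall_isApproximation`). Along
a stretch only a finite `profile` matters, so loops can be cut or pumped: stretches of every length
exist as soon as one of length `profileCount` does, with short words around it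
(`forall_isApproximation_iff`). This leaves a finite search, which is primitive recursive. -/

theorem value_eq (w : List (Fin k)) :
    value k w = Nat.ofDigits k (w.map fun a : Fin k => (a : ℕ)).reverse := by
  simp [value, ← List.map_eq_flatMap, Function.comp_def]

theorem value_append (u v : List (Fin k)) :
    value k (u ++ v) = k ^ v.length * value k u + value k v := by
  simp [value_eq, Nat.ofDigits_append, add_comm]

theorem value_lt (hk : 2 ≤ k) (w : List (Fin k)) : value k w < k ^ w.length := by
  have hdigits : ∀ x ∈ (w.map fun a : Fin k => (a : ℕ)).reverse, x < k := by
    intro x hx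
    obtain ⟨a, -, rfl⟩ := List.mem_map.1 (List.mem_reverse.1 hx)
    exact a.2
  simpa [value_eq] using Nat.ofDigits_lt_base_pow_length (by omega) hdigits

theorem numerator_append (u v : List (PairLetter k)) :
    numerator k (u ++ v) = k ^ v.length * numerator k u + numerator k v := by
  simp [numerator, value_append]

theorem denominator_append (u v : List (PairLetter k)) :
    denominator k (u ++ v) = k ^ v.length * denominator k u + denominator k v := by
  simp [denominator, value_append]

theorem numerator_lt (hk : 2 ≤ k) (w : List (PairLetter k)) :
    numerator k w < k ^ w.length := by
  simpa [numerator] using value_lt hk (w.map Prod.fst)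

theorem denominator_lt (hk : 2 ≤ k) (w : List (PairLetter k)) :
    denominator k w < k ^ w.length := by
  simpa [denominator] using value_lt hk (w.map Prod.snd)

@[simp] theorem denominator_nil : denominator k [] = 0 := by simp [denominator, value]

/-- A word with nonzero denominator has a prefix ending in its first nonzero denominator digit. -/
theorem exists_prefix_denominator_lt (hk : 2 ≤ k) (w : List (PairLetter k))
    (hw : denominator k w ≠ 0) :
    ∃ u v, w = u ++ v ∧ denominator k u ≠ 0 ∧ denominator k u < k := by
  induction w using List.reverseRecOn with
  | nil => simp at hw
  | append_singleton w l ih =>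
    by_cases h : denominator k w = 0
    · refine ⟨w ++ [l], [], by simp, hw, ?_⟩
      rw [denominator_append, h]
      simpa using denominator_lt hk [l]
    · obtain ⟨u, v, rfl, hu⟩ := ih h
      exact ⟨u, v ++ [l], by simp, hu⟩

/-! ### Growth of the deviation from p/q -/

/-- The integer `q · [π₁(w)]_k - p · [π₂(w)]_k`, which vanishes exactly when `quo_k(w) = p / q`. -/
def deviation (k p q : ℕ) (w : List (PairLetter k)) : ℤ :=
  q * numerator k w - p * denominator k w

theorem deviation_append (p q : ℕ) (u v : List (PairLetter k)) :
    deviation k p q (u ++ v) = k ^ v.length * deviation k p q u + deviation k p q v := by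
  simp only [deviation, numerator_append, denominator_append]
  push_cast
  ring

theorem abs_deviation_le (hk : 2 ≤ k) (p q : ℕ) (w : List (PairLetter k)) :
    |deviation k p q w| ≤ (p + q) * (k ^ w.length - 1) := by
  have hx : (numerator k w : ℤ) ≤ k ^ w.length - 1 := by
    have := numerator_lt hk w
    zify at this
    omega
  have hy : (denominator k w : ℤ) ≤ k ^ w.length - 1 := by
    have := denominator_lt hk w
    zify at this
    omega
  have h1 := mul_le_mul_of_nonneg_left hx (Int.natCast_nonneg q)
  have h2 := mul_le_mul_of_nonneg_left hy (Int.natCast_nonneg p)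
  have h3 : (0 : ℤ) ≤ q * numerator k w := by positivity
  have h4 : (0 : ℤ) ≤ p * denominator k w := by positivity
  rw [deviation, abs_le]
  constructor <;> linarith

/-- Once the deviation exceeds `p + q`, it grows at least geometrically. -/
theorem lt_abs_deviation_append (hk : 2 ≤ k) {p q : ℕ} {u : List (PairLetter k)}
    (hu : (p + q : ℤ) < |deviation k p q u|) (v : List (PairLetter k)) :
    (p + q + k ^ v.length : ℤ) ≤ |deviation k p q (u ++ v)| := by
  have hv := abs_deviation_le hk p q v
  have hpow : (0 : ℤ) ≤ (k : ℤ) ^ v.length := by positivity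
  have h1 : |(k : ℤ) ^ v.length * deviation k p q u| - |deviation k p q v| ≤
      |deviation k p q (u ++ v)| := by
    rw [deviation_append]
    have := abs_sub_abs_le_abs_sub ((k : ℤ) ^ v.length * deviation k p q u) (-deviation k p q v)
    rwa [abs_neg, sub_neg_eq_add] at this
  rw [abs_mul, abs_of_nonneg hpow] at h1
  -- Integrality gives |d(u)| ≥ p + q + 1; the extra 1 becomes the summand k ^ |v|.
  have h2 := mul_le_mul_of_nonneg_left (Int.add_one_le_of_lt hu) hpow
  linarith

/-! ### Accumulation points and long approximations -/

/-- The word `uvz` is accepted, has `quo_k ≠ p / q`, and along the factor `v` of length at least `N`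
its denominator is nonzero while its deviation from `p / q` stays bounded. -/
def IsApproximation {σ : Type*} (M : DFA (PairLetter k) σ) (p q N : ℕ)
    (u v z : List (PairLetter k)) : Prop :=
  N ≤ v.length ∧ u ++ v ++ z ∈ M.accepts ∧ denominator k u ≠ 0 ∧
    |deviation k p q (u ++ v)| ≤ p + q ∧ deviation k p q (u ++ v ++ z) ≠ 0

theorem quo_sub_eq {p q : ℕ} (hq : q ≠ 0) {w : List (PairLetter k)}
    (hw : denominator k w ≠ 0) :
    ((quo k w : ℚ) : ℝ) - p / q = (deviation k p q w : ℝ) / (q * denominator k w) := by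
  have h1 : (q : ℝ) ≠ 0 := by exact_mod_cast hq
  have h2 : (denominator k w : ℝ) ≠ 0 := by exact_mod_cast hw
  simp only [quo, deviation]
  push_cast
  field_simp

/-- The denominator is at least k ^ (|v| + |z|), since it is already nonzero after u, while reading
z multiplies the bounded deviation by only about k ^ |z|. -/
theorem IsApproximation.abs_quo_sub_le {σ : Type*} {M : DFA (PairLetter k) σ} (hk : 2 ≤ k)
    {p q N : ℕ} (hq : q ≠ 0) {u v z : List (PairLetter k)} (h : IsApproximation M p q N u v z) :
    |((quo k (u ++ v ++ z) : ℚ) : ℝ) - p / q| ≤ 2 * (p + q) / k ^ N := by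
  obtain ⟨hN, -, hu, hv, -⟩ := h
  have hk0 : (0 : ℝ) < k := by exact_mod_cast (by omega : 0 < k)
  have hden : k ^ z.length * k ^ v.length ≤ denominator k (u ++ v ++ z) := by
    rw [denominator_append, denominator_append]
    calc k ^ z.length * k ^ v.length
        ≤ k ^ z.length * (k ^ v.length * denominator k u + denominator k v) := by
          gcongr
          exact le_add_right (Nat.le_mul_of_pos_right _ (Nat.pos_of_ne_zero hu))
      _ ≤ _ := le_self_add
  have hdev : |deviation k p q (u ++ v ++ z)| ≤ k ^ z.length * (2 * (p + q)) := by
    have hz := abs_deviation_le hk p q z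
    have hpow : (0 : ℤ) ≤ (k : ℤ) ^ z.length := by positivity
    rw [deviation_append]
    refine (abs_add_le _ _).trans ?_
    rw [abs_mul, abs_of_nonneg hpow]
    have := mul_le_mul_of_nonneg_left hv hpow
    have h0 : (0 : ℤ) ≤ p + q := by positivity
    linarith
  have hden0 : denominator k (u ++ v ++ z) ≠ 0 := by
    have : 0 < k ^ z.length * k ^ v.length := by positivity
    omega
  have hden' : (k : ℝ) ^ z.length * k ^ N ≤ q * denominator k (u ++ v ++ z) := by
    have h1 : k ^ z.length * k ^ N ≤ k ^ z.length * k ^ v.length := by gcongr; omega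
    have h2 : denominator k (u ++ v ++ z) ≤ q * denominator k (u ++ v ++ z) :=
      Nat.le_mul_of_pos_left _ (Nat.pos_of_ne_zero hq)
    exact_mod_cast h1.trans (hden.trans h2)
  have hdev' : |(deviation k p q (u ++ v ++ z) : ℝ)| ≤ k ^ z.length * (2 * (p + q)) := by
    exact_mod_cast hdev
  rw [quo_sub_eq hq hden0, abs_div, abs_of_nonneg (by positivity : (0 : ℝ) ≤ q * _)]
  calc _ ≤ (k ^ z.length * (2 * (p + q)) : ℝ) / (k ^ z.length * k ^ N) := by gcongr
    _ = _ := by field_simp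

theorem exists_isApproximation {σ : Type*} {M : DFA (PairLetter k) σ} (hk : 2 ≤ k)
    {p q : ℕ} (N : ℕ) {w : List (PairLetter k)} (hw : w ∈ M.accepts)
    (hden : denominator k w ≠ 0) (hdev : deviation k p q w ≠ 0)
    (hlt : k ^ (N + 1) * |deviation k p q w| < denominator k w) :
    ∃ u v z, IsApproximation M p q N u v z := by
  obtain ⟨u, r, rfl, hu0, hu⟩ := exists_prefix_denominator_lt hk w hden
  have hupper : denominator k (u ++ r) < k ^ (r.length + 1) := by
    have hr := denominator_lt hk r
    have hm := Nat.mul_le_mul_left (k ^ r.length) (Nat.succ_le_of_lt hu)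
    rw [denominator_append, pow_succ]
    simp only [Nat.succ_eq_add_one, mul_add, mul_one] at hm
    omega
  -- With k ^ (|r| + 1) bounding the denominator, each power of k in the deviation costs one letter
  -- of r.
  have key : ∀ j : ℕ, (k : ℤ) ^ j ≤ |deviation k p q (u ++ r)| → N + j < r.length := by
    intro j hj
    have h1 : (k : ℤ) ^ (N + 1) * k ^ j < k ^ (r.length + 1) := by
      calc (k : ℤ) ^ (N + 1) * k ^ j ≤ k ^ (N + 1) * |deviation k p q (u ++ r)| := by gcongr
        _ < denominator k (u ++ r) := hlt
        _ < _ := by exact_mod_cast hupper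
    rw [← pow_add] at h1
    have := (pow_lt_pow_iff_right₀ (by exact_mod_cast hk : (1 : ℤ) < k)).1 h1
    omega
  have hlen := key 0 (by simpa using Int.one_le_abs hdev)
  refine ⟨u, r.take N, r.drop N, by simp; omega, by simpa using hw, hu0, ?_, by simpa using hdev⟩
  -- If the deviation had escaped by then, it would end up at least k ^ (|r| - N), and `key` would
  -- give |r| < |r|.
  by_contra! hbig
  have h2 := lt_abs_deviation_append hk hbig (r.drop N)
  rw [List.append_assoc, List.take_append_drop] at h2
  have := key (r.drop N).length (by linarith [Int.natCast_nonneg p, Int.natCast_nonneg q])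
  rw [List.length_drop] at this
  omega

/-- The rational `p / q` is an accumulation point of the accepted set exactly when there are
approximations of all lengths. -/
theorem accPt_iff_forall_isApproximation {σ : Type*} {M : DFA (PairLetter k) σ} {S : Set ℚ}
    (hk : 2 ≤ k) (hM : AcceptsRationals M S) {p q : ℕ} (hq : q ≠ 0) :
    AccPt ((p : ℝ) / (q : ℝ)) (Filter.principal ((fun x : ℚ => (x : ℝ)) '' S)) ↔
      ∀ N, ∃ u v z, IsApproximation M p q N u v z := by
  obtain ⟨hden, rfl⟩ := hM
  have hq0 : (0 : ℝ) < q := by exact_mod_cast Nat.pos_of_ne_zero hq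
  have hk0 : (0 : ℝ) < k := by exact_mod_cast (by omega : 0 < k)
  rw [accPt_iff_nhds]
  constructor
  · intro h N
    -- The radius is chosen so that, after cancelling q, the hypothesis of `exists_isApproximation`
    -- appears.
    obtain ⟨_, ⟨hball, _, ⟨w, hw, rfl⟩, rfl⟩, hne⟩ :=
      h _ (Metric.ball_mem_nhds _ (by positivity : (0 : ℝ) < 1 / (q * k ^ (N + 1))))
    have hw0 := hden w hw
    have hw0' : (0 : ℝ) < denominator k w := by exact_mod_cast Nat.pos_of_ne_zero hw0
    have hsub := quo_sub_eq (p := p) hq hw0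
    rw [Metric.mem_ball, Real.dist_eq, hsub, abs_div,
      abs_of_pos (by positivity : (0 : ℝ) < q * denominator k w),
      div_lt_div_iff₀ (by positivity) (by positivity), one_mul] at hball
    refine exists_isApproximation hk N hw hw0 (fun h0 => hne ?_) ?_
    · rw [h0] at hsub
      simpa [sub_eq_zero] using hsub
    · have : (k : ℝ) ^ (N + 1) * |(deviation k p q w : ℝ)| < denominator k w := by
        refine lt_of_mul_lt_mul_left ?_ hq0.le
        linarith
      exact_mod_cast this
  · intro h U hU
    obtain ⟨ε, hε, hball⟩ := Metric.mem_nhds_iff.1 hU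
    obtain ⟨N, hN⟩ := exists_nat_gt (2 * (p + q) / ε : ℝ)
    obtain ⟨u, v, z, ha⟩ := h N
    have hw0 := hden _ ha.2.1
    refine ⟨_, ⟨hball ?_, _, ⟨_, ha.2.1, rfl⟩, rfl⟩, fun h0 => ?_⟩
    · rw [Metric.mem_ball, Real.dist_eq]
      refine (ha.abs_quo_sub_le hk hq).trans_lt ?_
      have h1 : (N : ℝ) < k ^ N := by exact_mod_cast Nat.lt_pow_self (by omega : 1 < k)
      rw [div_lt_iff₀ hε] at hN
      rw [div_lt_iff₀ (by positivity)]
      nlinarith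
    · have hsub := quo_sub_eq (p := p) hq hw0
      rw [sub_eq_zero.2 h0, eq_comm, div_eq_zero_iff] at hsub
      have hw0' : (denominator k (u ++ v ++ z) : ℝ) ≠ 0 := by exact_mod_cast hw0
      rcases hsub with h | h
      · exact ha.2.2.2.2 (by exact_mod_cast h)
      · exact mul_ne_zero hq0.ne' hw0' h

/-! ### Finite profiles and pumping -/

/-- `d` if `|d| ≤ C`, and a point at infinity otherwise. -/
noncomputable def clamp (C : ℕ) (d : ℤ) : Option (Finset.Icc (-(C : ℤ)) C) :=
  if h : d ∈ Finset.Icc (-(C : ℤ)) C then some ⟨d, h⟩ else none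

theorem clamp_eq_clamp_iff {C : ℕ} {d e : ℤ} :
    clamp C d = clamp C e ↔ d = e ∨ (C : ℤ) < |d| ∧ (C : ℤ) < |e| := by
  have key : ∀ x : ℤ, x ∈ Finset.Icc (-(C : ℤ)) C ↔ ¬ (C : ℤ) < |x| := by
    simp [abs_le]
  unfold clamp
  split_ifs with hd he he <;> rw [key] at hd he
  · simp [hd]
  · simp only [false_iff]
    grind
  · simp only [false_iff]
    grind
  · simp_all

/-- The information on the prefix `w` that is relevant for reading on: the state of `M`, the
deviation as long as it is bounded, and whether the denominator is nonzero. -/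
noncomputable def profile (M : DFA (PairLetter k) (Fin n)) (p q : ℕ) (w : List (PairLetter k)) :
    Fin n × Option (Finset.Icc (-((p + q : ℕ) : ℤ)) (p + q : ℕ)) × Bool :=
  (M.eval w, clamp (p + q) (deviation k p q w), decide (denominator k w = 0))

theorem profile_eq_profile_iff {M : DFA (PairLetter k) (Fin n)} {p q : ℕ}
    {u v : List (PairLetter k)} :
    profile M p q u = profile M p q v ↔ M.eval u = M.eval v ∧
      (deviation k p q u = deviation k p q v ∨
        (p + q : ℤ) < |deviation k p q u| ∧ (p + q : ℤ) < |deviation k p q v|) ∧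
      (denominator k u = 0 ↔ denominator k v = 0) := by
  rw [profile, profile, Prod.mk.injEq, Prod.mk.injEq, clamp_eq_clamp_iff, decide_eq_decide]
  push_cast
  rfl

/-- Infinity is absorbing because escaped deviations stay escaped, so equality of profiles is a
right congruence. -/
theorem profile_append_congr (hk : 2 ≤ k) {M : DFA (PairLetter k) (Fin n)} {p q : ℕ}
    {u v : List (PairLetter k)} (h : profile M p q u = profile M p q v)
    (w : List (PairLetter k)) : profile M p q (u ++ w) = profile M p q (v ++ w) := by
  rw [profile_eq_profile_iff] at h ⊢
  obtain ⟨hM, hdev, hden⟩ := h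
  refine ⟨?_, ?_, ?_⟩
  · simp only [DFA.eval, DFA.evalFrom_of_append] at hM ⊢
    rw [hM]
  · rcases hdev with h | ⟨hu, hv⟩
    · simp [deviation_append, h]
    · have hpow : (0 : ℤ) < (k : ℤ) ^ w.length := by positivity
      have h1 := lt_abs_deviation_append hk hu w
      have h2 := lt_abs_deviation_append hk hv w
      exact Or.inr ⟨by linarith, by linarith⟩
  · have : k ≠ 0 := by omega
    simp [denominator_append, this, hden]

/-- The number of profiles. -/
def profileCount (n p q : ℕ) : ℕ := n * ((2 * (p + q) + 2) * 2)

/-- Pigeonhole on the |v| + 1 prefixes of v. -/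
theorem exists_profile_loop (M : DFA (PairLetter k) (Fin n)) (p q : ℕ)
    (u v : List (PairLetter k)) (hv : profileCount n p q ≤ v.length) :
    ∃ a b c, v = a ++ b ++ c ∧ b ≠ [] ∧
      profile M p q (u ++ a) = profile M p q (u ++ a ++ b) := by
  have hcard : Fintype.card (Fin n × Option (Finset.Icc (-((p + q : ℕ) : ℤ)) (p + q : ℕ)) × Bool) <
      Fintype.card (Fin (v.length + 1)) := by
    have : Fintype.card (Fin n × Option (Finset.Icc (-((p + q : ℕ) : ℤ)) (p + q : ℕ)) × Bool) =
        profileCount n p q := by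
      simp only [Fintype.card_prod, Fintype.card_fin, Fintype.card_option, Fintype.card_coe,
        Int.card_Icc, Fintype.card_bool, profileCount]
      congr 2
      omega
    rw [this, Fintype.card_fin]
    omega
  obtain ⟨i, j, hij, h⟩ := Fintype.exists_ne_map_eq_of_card_lt
    (fun i : Fin (v.length + 1) => profile M p q (u ++ v.take i)) hcard
  wlog hlt : i < j generalizing i j
  · exact this j i hij.symm h.symm (lt_of_le_of_ne (not_lt.1 hlt) hij.symm)
  have hj : v.take j = v.take i ++ (v.drop i).take (j - i) := by
    rw [← List.take_add]
    congr 1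
    omega
  refine ⟨v.take i, (v.drop i).take (j - i), v.drop j, ?_, ?_, ?_⟩
  · rw [← hj, List.take_append_drop]
  · intro h0
    have := congrArg List.length h0
    simp only [List.length_take, List.length_drop, List.length_nil] at this
    omega
  · rw [List.append_assoc, ← hj]
    exact h

theorem exists_short_profile_eq (hk : 2 ≤ k) (M : DFA (PairLetter k) (Fin n)) (p q : ℕ)
    (u v : List (PairLetter k)) :
    ∃ v' : List (PairLetter k), v'.length ≤ profileCount n p q ∧
      profile M p q (u ++ v') = profile M p q (u ++ v) := by
  induction hl : v.length using Nat.strong_induction_on generalizing v with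
  | _ l ih =>
    by_cases hv : v.length ≤ profileCount n p q
    · exact ⟨v, hv, rfl⟩
    obtain ⟨a, b, c, rfl, hb, hab⟩ := exists_profile_loop M p q u v (by omega)
    have hb' := List.length_pos_iff.2 hb
    simp only [List.length_append] at hl
    obtain ⟨v', hv', he⟩ := ih (a ++ c).length (by simp; omega) (a ++ c) rfl
    refine ⟨v', hv', he.trans ?_⟩
    simpa using profile_append_congr hk hab c

/-- Apart from the length of the middle factor, every condition can be read off the three profiles.
-/
theorem IsApproximation.congr {M : DFA (PairLetter k) (Fin n)} {p q N N' : ℕ}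
    {u v z u' v' z' : List (PairLetter k)} (h : IsApproximation M p q N u v z)
    (hN : N' ≤ v'.length) (hu : profile M p q u' = profile M p q u)
    (hv : profile M p q (u' ++ v') = profile M p q (u ++ v))
    (hz : profile M p q (u' ++ v' ++ z') = profile M p q (u ++ v ++ z)) :
    IsApproximation M p q N' u' v' z' := by
  rw [profile_eq_profile_iff] at hu hv hz
  obtain ⟨-, hacc, hden, hdev, hne⟩ := h
  refine ⟨hN, ?_, by rwa [Ne, hu.2.2], ?_, ?_⟩
  · rw [DFA.mem_accepts] at hacc ⊢
    rwa [hz.1]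
  · rcases hv.2.1 with h | h
    · rwa [h]
    · omega
  · rcases hz.2.1 with h | h
    · rwa [h]
    -- Deviation zero is never sent to infinity.
    · intro h0
      rw [h0, abs_zero] at h
      omega

/-- An approximation whose middle factor has `profileCount` letters can be pumped up. -/
theorem IsApproximation.exists_of_le (hk : 2 ≤ k) {M : DFA (PairLetter k) (Fin n)} {p q : ℕ}
    {u v z : List (PairLetter k)} (h : IsApproximation M p q (profileCount n p q) u v z) (N : ℕ) :
    ∃ v', IsApproximation M p q N u v' z := by
  -- The stronger bound keeps the middle factor long enough to contain a loop at each step.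
  suffices ∃ v', IsApproximation M p q (profileCount n p q + N) u v' z by
    obtain ⟨v', hv'⟩ := this
    exact ⟨v', (Nat.le_add_left _ _).trans hv'.1, hv'.2⟩
  induction N with
  | zero => exact ⟨v, h⟩
  | succ N ih =>
    obtain ⟨v, hv⟩ := ih
    obtain ⟨a, b, c, rfl, hb, hab⟩ := exists_profile_loop M p q u v (by have := hv.1; omega)
    have hb' := List.length_pos_iff.2 hb
    have hlen := hv.1
    simp only [List.length_append] at hlen
    have hp : ∀ c', profile M p q (u ++ (a ++ b ++ b ++ c')) =
        profile M p q (u ++ (a ++ b ++ c')) := fun c' => by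
      simpa using (profile_append_congr hk hab (b ++ c')).symm
    refine ⟨a ++ b ++ b ++ c, hv.congr ?_ rfl (hp c) ?_⟩
    · simp only [List.length_append]
      omega
    · simpa using hp (c ++ z)

/-- Approximations of all lengths exist as soon as there is one among finitely many words. -/
theorem forall_isApproximation_iff (hk : 2 ≤ k) (M : DFA (PairLetter k) (Fin n)) (p q : ℕ) :
    (∀ N, ∃ u v z, IsApproximation M p q N u v z) ↔
      ∃ u v z, u.length ≤ profileCount n p q ∧ v.length ≤ profileCount n p q ∧
        z.length ≤ profileCount n p q ∧ IsApproximation M p q (profileCount n p q) u v z := by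
  constructor
  · intro h
    obtain ⟨u, v, z, h⟩ := h (profileCount n p q)
    obtain ⟨u', hu', hu⟩ := exists_short_profile_eq hk M p q [] u
    simp only [List.nil_append] at hu
    have hlen := h.1
    -- The middle factor is cut to exactly the pumping length and its remainder moved into z; only u
    -- and z are then shortened by removing loops.
    set v₁ := v.take (profileCount n p q)
    set v₂ := v.drop (profileCount n p q)
    have hvv : v₁ ++ v₂ = v := List.take_append_drop _ _
    obtain ⟨z', hz', hz⟩ := exists_short_profile_eq hk M p q (u ++ v₁) (v₂ ++ z)
    have hv₁ : v₁.length = profileCount n p q := by simp [v₁, hlen]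
    have h₁ : IsApproximation M p q (profileCount n p q) u v₁ (v₂ ++ z) := by
      obtain ⟨-, hacc, hden, hdev, hne⟩ := h
      have hw : u ++ v₁ ++ (v₂ ++ z) = u ++ v ++ z := by simp [← hvv]
      refine ⟨hv₁.ge, by rwa [hw], hden, ?_, by rwa [hw]⟩
      by_contra! hbig
      have := lt_abs_deviation_append hk hbig v₂
      rw [List.append_assoc, hvv] at this
      have hpow : (0 : ℤ) < (k : ℤ) ^ v₂.length := by positivity
      linarith
    refine ⟨u', v₁, z', hu', hv₁.le, hz', h₁.congr hv₁.ge hu (profile_append_congr hk hu _) ?_⟩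
    rw [← hz]
    simpa using profile_append_congr hk hu (v₁ ++ z')
  · rintro ⟨u, v, z, -, -, -, h⟩ N
    obtain ⟨v', h'⟩ := h.exists_of_le hk N
    exact ⟨u, v', z, h'⟩

/-! ### Primitive recursive search -/

/-- The value of a word of digits in base `k`, computed by Horner's scheme. -/
def hornerValue (k : ℕ) (w : List ℕ) : ℕ := w.foldl (fun x a => k * x + a) 0

/-- The state reached from the start state after reading `w`, read off from the description. -/
def codeEval (c : DFACode) (w : List (ℕ × ℕ)) : ℕ :=
  w.foldl (fun s l => ((c.2.2.2.2.getD s []).getD l.1 []).getD l.2 0) c.2.2.1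

/-- All words of length at most `m` over the alphabet `Σ_k × Σ_k`. -/
def boundedWords (k m : ℕ) : List (List (ℕ × ℕ)) :=
  m.rec [[]] fun _ W => [] :: W.flatMap fun w =>
    (List.range k).flatMap fun a => (List.range k).map fun b => (a, b) :: w

/-- `IsApproximation` in terms of the description of the automaton. -/
def CodeApproximation (x : DFACode × ℕ × ℕ) (u v z : List (ℕ × ℕ)) : Prop :=
  profileCount x.1.2.1 x.2.1 x.2.2 ≤ v.length ∧
  x.1.2.2.2.1.getD (codeEval x.1 (u ++ v ++ z)) false = true ∧
  hornerValue x.1.1 (u.map Prod.snd) ≠ 0 ∧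
  (x.2.2 * hornerValue x.1.1 ((u ++ v).map Prod.fst) ≤
      x.2.1 * hornerValue x.1.1 ((u ++ v).map Prod.snd) + (x.2.1 + x.2.2) ∧
    x.2.1 * hornerValue x.1.1 ((u ++ v).map Prod.snd) ≤
      x.2.2 * hornerValue x.1.1 ((u ++ v).map Prod.fst) + (x.2.1 + x.2.2)) ∧
  x.2.2 * hornerValue x.1.1 ((u ++ v ++ z).map Prod.fst) ≠
    x.2.1 * hornerValue x.1.1 ((u ++ v ++ z).map Prod.snd)

/-- The words to be searched for an approximation. -/
def searchWords (x : DFACode × ℕ × ℕ) : List (List (ℕ × ℕ)) :=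
  boundedWords x.1.1 (profileCount x.1.2.1 x.2.1 x.2.2)

section Primrec

open Primrec

theorem primrec_hornerValue : Primrec₂ hornerValue := by
  refine (list_foldl (f := fun x : ℕ × List ℕ => x.2) (g := fun _ => 0)
    (h := fun x y => x.1 * y.1 + y.2) snd (const 0) ?_)
  exact nat_add.comp (nat_mul.comp (fst.comp fst) (fst.comp snd)) (snd.comp snd)

theorem primrec_codeEval : Primrec₂ codeEval := by
  refine (list_foldl (f := fun x : DFACode × List (ℕ × ℕ) => x.2) (g := fun x => x.1.2.2.1)
    (h := fun x y => ((x.1.2.2.2.2.getD y.1 []).getD y.2.1 []).getD y.2.2 0) snd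
    (fst.comp (snd.comp (snd.comp fst))) ?_)
  refine (list_getD 0).comp ((list_getD []).comp ((list_getD []).comp ?_ (fst.comp snd))
    (fst.comp (snd.comp snd))) (snd.comp (snd.comp snd))
  exact snd.comp (snd.comp (snd.comp (snd.comp (fst.comp fst))))

theorem primrec_boundedWords : Primrec₂ boundedWords := by
  refine nat_rec (f := fun _ : ℕ => [[]]) (g := fun k x => [] :: x.2.flatMap fun w =>
    (List.range k).flatMap fun a => (List.range k).map fun b => (a, b) :: w) (const _) ?_
  refine list_cons.comp (const []) (list_flatMap (snd.comp snd) ?_)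
  refine list_flatMap (list_range.comp (fst.comp fst)) ?_
  refine list_map (list_range.comp (fst.comp (fst.comp fst))) ?_
  exact list_cons.comp (Primrec.pair (snd.comp fst) snd) (snd.comp (fst.comp fst))

theorem primrec_profileCount :
    Primrec fun x : DFACode × ℕ × ℕ => profileCount x.1.2.1 x.2.1 x.2.2 :=
  nat_mul.comp (fst.comp (snd.comp fst)) (nat_mul.comp (nat_add.comp (nat_mul.comp (const 2)
    (nat_add.comp (fst.comp snd) (snd.comp snd))) (const 2)) (const 2))

theorem primrec_searchWords : Primrec searchWords :=
  primrec_boundedWords.comp (fst.comp fst) primrec_profileCount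

theorem primrecPred_exists_mem {α β : Type*} [Primcodable α] [Primcodable β] {f : α → List β}
    {R : α → β → Prop} (hf : Primrec f) (hR : PrimrecRel R) :
    PrimrecPred fun a => ∃ b ∈ f a, R a b :=
  (PrimrecRel.exists_mem_list (R := fun b a => R a b)
    (PrimrecPred.comp hR (Primrec.pair snd fst))).comp hf .id

theorem primrecPred_codeApproximation :
    PrimrecPred fun y : (((DFACode × ℕ × ℕ) × List (ℕ × ℕ)) × List (ℕ × ℕ)) × List (ℕ × ℕ) =>
      CodeApproximation y.1.1.1 y.1.1.2 y.1.2 y.2 := by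
  let α := (((DFACode × ℕ × ℕ) × List (ℕ × ℕ)) × List (ℕ × ℕ)) × List (ℕ × ℕ)
  have hx : Primrec fun y : α => y.1.1.1 := fst.comp (fst.comp fst)
  have hu : Primrec fun y : α => y.1.1.2 := snd.comp (fst.comp fst)
  have hv : Primrec fun y : α => y.1.2 := snd.comp fst
  have huv : Primrec fun y : α => y.1.1.2 ++ y.1.2 := list_append.comp hu hv
  have huvz : Primrec fun y : α => y.1.1.2 ++ y.1.2 ++ y.2 := list_append.comp huv snd
  have hp : Primrec fun y : α => y.1.1.1.2.1 := fst.comp (snd.comp hx)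
  have hq : Primrec fun y : α => y.1.1.1.2.2 := snd.comp (snd.comp hx)
  have hnum : ∀ {f : α → List (ℕ × ℕ)}, Primrec f →
      Primrec fun y => hornerValue y.1.1.1.1.1 ((f y).map Prod.fst) := fun hf =>
    primrec_hornerValue.comp (fst.comp (fst.comp hx)) (list_map hf (fst.comp snd))
  have hden : ∀ {f : α → List (ℕ × ℕ)}, Primrec f →
      Primrec fun y => hornerValue y.1.1.1.1.1 ((f y).map Prod.snd) := fun hf =>
    primrec_hornerValue.comp (fst.comp (fst.comp hx)) (list_map hf (snd.comp snd))
  have hacc : Primrec fun y : α => y.1.1.1.1.2.2.2.1.getD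
      (codeEval y.1.1.1.1 (y.1.1.2 ++ y.1.2 ++ y.2)) false :=
    (list_getD false).comp (fst.comp (snd.comp (snd.comp (snd.comp (fst.comp hx)))))
      (primrec_codeEval.comp (fst.comp hx) huvz)
  refine (nat_le.comp (primrec_profileCount.comp hx) (list_length.comp hv)).and
    ((Primrec.eq.comp hacc (const true)).and ((Primrec.eq.comp (hden hu) (const 0)).not.and
    (((nat_le.comp ?_ ?_).and (nat_le.comp ?_ ?_)).and (Primrec.eq.comp ?_ ?_).not)))
  · exact nat_mul.comp hq (hnum huv)
  · exact nat_add.comp (nat_mul.comp hp (hden huv)) (nat_add.comp hp hq)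
  · exact nat_mul.comp hp (hden huv)
  · exact nat_add.comp (nat_mul.comp hq (hnum huv)) (nat_add.comp hp hq)
  · exact nat_mul.comp hq (hnum huvz)
  · exact nat_mul.comp hp (hden huvz)

theorem primrecPred_exists_codeApproximation :
    PrimrecPred fun x => ∃ u ∈ searchWords x, ∃ v ∈ searchWords x, ∃ z ∈ searchWords x,
      CodeApproximation x u v z :=
  primrecPred_exists_mem primrec_searchWords <|
    primrecPred_exists_mem (f := fun y : _ × _ => searchWords y.1) (primrec_searchWords.comp fst) <|
      primrecPred_exists_mem (f := fun y : (_ × _) × _ => searchWords y.1.1)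
        (primrec_searchWords.comp (fst.comp fst)) primrecPred_codeApproximation

end Primrec

/-! ### Correctness of the search on automaton codes -/

/-- A word over `Σ_k × Σ_k` as a word of pairs of natural numbers. -/
def natWord (w : List (PairLetter k)) : List (ℕ × ℕ) := w.map fun l => ((l.1 : ℕ), (l.2 : ℕ))

@[simp] theorem natWord_append (u v : List (PairLetter k)) :
    natWord (u ++ v) = natWord u ++ natWord v := List.map_append

@[simp] theorem length_natWord (w : List (PairLetter k)) : (natWord w).length = w.length :=
  List.length_map _

theorem mem_boundedWords_iff {m : ℕ} {x : List (ℕ × ℕ)} :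
    x ∈ boundedWords k m ↔ ∃ w : List (PairLetter k), w.length ≤ m ∧ natWord w = x := by
  induction m generalizing x with
  | zero => simp [boundedWords, natWord, eq_comm]
  | succ m ih =>
    change x ∈ [] :: (boundedWords k m).flatMap _ ↔ _
    simp only [List.mem_cons, List.mem_flatMap, List.mem_map, List.mem_range, ih]
    constructor
    · rintro (rfl | ⟨_, ⟨w, hw, rfl⟩, a, ha, b, hb, rfl⟩)
      · exact ⟨[], by simp, rfl⟩
      · exact ⟨(⟨a, ha⟩, ⟨b, hb⟩) :: w, by simpa using hw, rfl⟩
    · rintro ⟨_ | ⟨⟨a, b⟩, w⟩, hw, rfl⟩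
      · exact Or.inl rfl
      · exact Or.inr ⟨natWord w, ⟨w, by simpa using hw, rfl⟩, a, a.2, b, b.2, rfl⟩

theorem hornerValue_map (w : List (Fin k)) :
    hornerValue k (w.map fun a : Fin k => (a : ℕ)) = value k w := by
  induction w using List.reverseRecOn with
  | nil => simp [hornerValue, value_eq]
  | append_singleton w a ih =>
    rw [value_append, ← ih]
    simp [hornerValue, value_eq]

theorem hornerValue_natWord_fst (w : List (PairLetter k)) :
    hornerValue k ((natWord w).map Prod.fst) = numerator k w := by
  rw [numerator, ← hornerValue_map]
  simp [natWord, Function.comp_def]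

theorem hornerValue_natWord_snd (w : List (PairLetter k)) :
    hornerValue k ((natWord w).map Prod.snd) = denominator k w := by
  rw [denominator, ← hornerValue_map]
  simp [natWord, Function.comp_def]

/-- Indices from `Fin` are in range, so on the code of an automaton the defaults in `codeEval` and
`CodeApproximation` are never reached. -/
theorem getD_ofFn {α : Type*} {m : ℕ} (f : Fin m → α) (i : Fin m) (d : α) :
    (List.ofFn f).getD i d = f i := by
  simp [List.getD_eq_getElem?_getD]

theorem codeEval_natWord (M : DFA (PairLetter k) (Fin n)) (w : List (PairLetter k)) :
    codeEval (dfaCode M) (natWord w) = M.eval w := by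
  induction w using List.reverseRecOn with
  | nil => simp [codeEval, natWord, dfaCode]
  | append_singleton w l ih =>
    rw [DFA.eval_append_singleton, natWord_append, codeEval, List.foldl_append]
    change ((((dfaCode M).2.2.2.2).getD (codeEval (dfaCode M) (natWord w)) []).getD l.1 []).getD
      l.2 0 = _
    rw [ih, dfaCode]
    simp only [getD_ofFn]

theorem codeApproximation_natWord_iff (M : DFA (PairLetter k) (Fin n)) (p q : ℕ)
    (u v z : List (PairLetter k)) :
    CodeApproximation (dfaCode M, p, q) (natWord u) (natWord v) (natWord z) ↔
      IsApproximation M p q (profileCount n p q) u v z := by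
  have hacc : (dfaCode M).2.2.2.1.getD (M.eval (u ++ v ++ z) : ℕ) false = true ↔
      u ++ v ++ z ∈ M.accepts := by
    simp only [dfaCode, getD_ofFn, decide_eq_true_iff, DFA.mem_accepts]
  -- The absolute value becomes two inequalities over `ℕ`, where subtraction would truncate.
  have hdev : ∀ w : List (PairLetter k), (|deviation k p q w| ≤ p + q ↔
      q * numerator k w ≤ p * denominator k w + (p + q) ∧
        p * denominator k w ≤ q * numerator k w + (p + q)) := by
    intro w
    rw [deviation, abs_le]
    zify
    constructor <;> rintro ⟨h1, h2⟩ <;> constructor <;> linarith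
  have hne : ∀ w : List (PairLetter k), (deviation k p q w ≠ 0 ↔
      q * numerator k w ≠ p * denominator k w) := by
    intro w
    rw [deviation, Ne, sub_eq_zero]
    norm_cast
  simp only [CodeApproximation, IsApproximation, ← natWord_append, length_natWord,
    codeEval_natWord, hacc, hdev, hne]
  change _ ∧ _ ∧ hornerValue k _ ≠ 0 ∧ (q * hornerValue k _ ≤ p * hornerValue k _ + _ ∧
    p * hornerValue k _ ≤ q * hornerValue k _ + _) ∧
    q * hornerValue k _ ≠ p * hornerValue k _ ↔ _
  simp only [hornerValue_natWord_fst, hornerValue_natWord_snd]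
  rfl

theorem exists_codeApproximation_iff (M : DFA (PairLetter k) (Fin n)) (p q : ℕ) :
    (∃ u ∈ searchWords (dfaCode M, p, q), ∃ v ∈ searchWords (dfaCode M, p, q),
      ∃ z ∈ searchWords (dfaCode M, p, q), CodeApproximation (dfaCode M, p, q) u v z) ↔
    ∃ u v z, u.length ≤ profileCount n p q ∧ v.length ≤ profileCount n p q ∧
      z.length ≤ profileCount n p q ∧ IsApproximation M p q (profileCount n p q) u v z := by
  have hmem : ∀ x, x ∈ searchWords (dfaCode M, p, q) ↔
      ∃ w : List (PairLetter k), w.length ≤ profileCount n p q ∧ natWord w = x :=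
    fun x => mem_boundedWords_iff
  simp only [hmem]
  constructor
  · rintro ⟨_, ⟨u, hu, rfl⟩, _, ⟨v, hv, rfl⟩, _, ⟨z, hz, rfl⟩, h⟩
    exact ⟨u, v, z, hu, hv, hz, (codeApproximation_natWord_iff M p q u v z).1 h⟩
  · rintro ⟨u, v, z, hu, hv, hz, h⟩
    exact ⟨_, ⟨u, hu, rfl⟩, _, ⟨v, hv, rfl⟩, _, ⟨z, hz, rfl⟩,
      (codeApproximation_natWord_iff M p q u v z).2 h⟩

end AutomaticRationals

open AutomaticRationals in
theorem mainTheorem12 :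
    ∃ decider : DFACode × ℕ × ℕ → Bool, Computable decider ∧
      ∀ (k n : ℕ) (M : DFA (PairLetter k) (Fin n)) (S : Set ℚ) (p q : ℕ),
        2 ≤ k → AcceptsRationals M S → q ≠ 0 →
          (decider (dfaCode M, p, q) = true ↔
            AccPt ((p : ℝ) / (q : ℝ)) (Filter.principal ((fun x : ℚ => (x : ℝ)) '' S))) := by
  classical
  -- The search is total on all tuples, including those that encode no automaton.
  refine ⟨_, primrecPred_exists_codeApproximation.decide.to_comp, ?_⟩
  intro k n M S p q hk hM hq
  rw [decide_eq_true_iff, exists_codeApproximation_iff, ← forall_isApproximation_iff hk,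
    ← accPt_iff_forall_isApproximation hk hM hq]
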